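/- For a finite set $E$ of edges in a graph, a fractional matching for $E$ is a function $f\colon E\to\mathbb{R}_{\ge 0}$ such that $\sum_{e\in E,\, e\ni v} f(e)\le 1$ for every vertex $v$; its size is $\sum_{e\in E} f(e)$, and $\nu^*(E)$ denotes the maximal size of a fractional matching for $E$. Given a family $E_1,\ldots,E_m$ of (not necessarily distinct) finite sets of edges in a graph, a rainbow fractional matching of size $n$ is a set of edges $\{e_1,\ldots,e_k\}$ with $e_i\in E_{\sigma(i)}$, $i=1,\ldots,k$, so that $\sigma(1),\ldots,\sigma(k)$ are distinct, together with a fractional matching $f\colon\{e_1,\ldots,e_k\}\to\mathbb{R}_{\ge 0}$ of size $n$. Theorem. Let $n$ be a positive integer or half-integer (that is, $n>0$ and $2n$ is an integer). Any family $E_1,\ldots,E_{2n}$ of finite sets of edges in an arbitrary graph, such that $\nu^*(E_i)\ge n$ for $i=1,\ldots,2n$, has a rainbow fractional matching of size $n$. -/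

import Mathlib

open Classical in
/-- `f` is a fractional matching for the finite set `E` of edges: it is nonnegative on `E`, and the
total weight of the edges of `E` at any vertex is at most `1`. Only the values of `f` on `E`
matter. -/
def IsFractionalMatching {V : Type*} (E : Finset (Sym2 V)) (f : Sym2 V → ℝ) : Prop :=
  (∀ e ∈ E, 0 ≤ f e) ∧ ∀ v : V, ∑ e ∈ E with v ∈ e, f e ≤ 1

/-- The size of a function `f` on the set `E` of edges. -/
def fractionalSize {V : Type*} (E : Finset (Sym2 V)) (f : Sym2 V → ℝ) : ℝ :=
  ∑ e ∈ E, f e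

/-- The set of sizes of fractional matchings for `E`. -/
def fractionalSizes {V : Type*} (E : Finset (Sym2 V)) : Set ℝ :=
  {s | ∃ f : Sym2 V → ℝ, IsFractionalMatching E f ∧ fractionalSize E f = s}

/-- The fractional matching number `ν*(E)`: the largest size of a fractional matching for `E`.
The set of sizes is nonempty and bounded (see the next two lemmas), so the supremum is genuine. -/
noncomputable def fractionalMatchingNumber {V : Type*} (E : Finset (Sym2 V)) : ℝ :=
  sSup (fractionalSizes E)

theorem fractionalSizes_nonempty {V : Type*} (E : Finset (Sym2 V)) :
    (fractionalSizes E).Nonempty :=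
  ⟨0, fun _ => 0, ⟨fun _ _ => le_rfl, fun _ => by simp⟩, by simp [fractionalSize]⟩

theorem fractionalSizes_bddAbove {V : Type*} (E : Finset (Sym2 V)) :
    BddAbove (fractionalSizes E) := by
  classical
  refine ⟨E.card, ?_⟩
  rintro s ⟨f, ⟨h0, h1⟩, rfl⟩
  have key : ∀ e ∈ E, f e ≤ 1 := by
    intro e he
    obtain ⟨v, hv⟩ : ∃ v, v ∈ e := ⟨e.out.1, Sym2.out_fst_mem e⟩
    refine le_trans ?_ (h1 v)
    exact Finset.single_le_sum (f := f) (fun x hx => h0 x (Finset.mem_filter.1 hx).1)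
      (Finset.mem_filter.2 ⟨he, hv⟩)
  simpa [fractionalSize] using Finset.sum_le_sum key

/-- The family `E` of sets of edges has a rainbow fractional matching of size `n`: there is a
finite set `S` of edges, taken from distinct members of the family (as witnessed by the injection
`σ`), together with a fractional matching for `S` of size `n`. -/
def HasRainbowFractionalMatching {V ι : Type*} (E : ι → Finset (Sym2 V)) (n : ℝ) : Prop :=
  ∃ (S : Finset (Sym2 V)) (σ : {e // e ∈ S} → ι) (f : Sym2 V → ℝ),
    Function.Injective σ ∧ (∀ e : {e // e ∈ S}, (e : Sym2 V) ∈ E (σ e)) ∧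
      IsFractionalMatching S f ∧ fractionalSize S f = n

/-! Vertex loads above `1` are allowed but penalized: over all weights with rainbow support,
maximize the size minus `K` times the sum of squared excesses. A feasible set that is a finite union
of compact boxes makes a maximizer `f` exist. Its first-order conditions give vertex prices `2 * K *
excess`: an edge of the support has price at most `1` (`price_le_one`), and an edge that can join
the support keeping it rainbow has price at least `1` (`one_le_price`).

If the support has fewer than `2n` edges, some `E i` is unused and the prices form a fractional
vertex cover of it. By weak duality the prices sum to at least `n`. Priced vertices have load above
`1`, so the sum is at most `∑ f e * price e ≤ ∑ f e`.

If the support has at least `2n` edges, choose `f` among the maximizers with fewest strict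
inequalities. Linear algebra (`exists_slackCount_lt`) then gives at least as many vertices of load
at least `1` as support edges. Each edge has at most two ends, so `2 * ∑ f e ≥ 2n`.

Loads are at most `1 + 1 / (2 * K)`; large `K` and compactness bring this down to `1`
(`exists_load_le_one`). -/

namespace FractionalMatching

open Finset Classical

variable {V ι : Type*}

/-! ### Loads, penalties and rainbow weights -/

/-- The total weight of the edges of `A` at the vertex `v`. -/
noncomputable def load (A : Finset (Sym2 V)) (f : Sym2 V → ℝ) (v : V) : ℝ :=
  ∑ e ∈ A with v ∈ e, f e

/-- The amount by which the load at `v` exceeds `1`. -/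
noncomputable def excess (A : Finset (Sym2 V)) (f : Sym2 V → ℝ) (v : V) : ℝ :=
  max 0 (load A f v - 1)

/-- The vertices covered by the edges of `A`. -/
noncomputable def vertices (A : Finset (Sym2 V)) : Finset V :=
  A.biUnion Sym2.toFinset

/-- The size of `f`, with a quadratic penalty for overloaded vertices. -/
noncomputable def penalizedSize (K : ℝ) (A : Finset (Sym2 V)) (f : Sym2 V → ℝ) : ℝ :=
  ∑ e ∈ A, f e - K * ∑ v ∈ vertices A, excess A f v ^ 2

/-- The marginal penalty for increasing `f e`. -/
noncomputable def price (K : ℝ) (A : Finset (Sym2 V)) (f : Sym2 V → ℝ) (e : Sym2 V) : ℝ :=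
  ∑ v ∈ e.toFinset, 2 * K * excess A f v

/-- The edges of `S` can be chosen from distinct members of the family `E`. -/
def IsRainbow (E : ι → Finset (Sym2 V)) (S : Finset (Sym2 V)) : Prop :=
  ∃ σ : Sym2 V → ι, Set.InjOn σ S ∧ ∀ e ∈ S, e ∈ E (σ e)

/-- The weight functions with values in `[0, 2]` supported on a rainbow subset of `A`. -/
def rainbowWeights (E : ι → Finset (Sym2 V)) (A : Finset (Sym2 V)) : Set (Sym2 V → ℝ) :=
  {f | (∀ e, 0 ≤ f e ∧ f e ≤ 2) ∧ ∃ S ⊆ A, IsRainbow E S ∧ ∀ e ∉ S, f e = 0}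

/-- The edges of `A` of nonzero weight. -/
noncomputable def supp (A : Finset (Sym2 V)) (f : Sym2 V → ℝ) : Finset (Sym2 V) :=
  {e ∈ A | f e ≠ 0}

theorem IsRainbow.mono {E : ι → Finset (Sym2 V)} {S T : Finset (Sym2 V)} (h : IsRainbow E T)
    (hST : S ⊆ T) : IsRainbow E S := by
  obtain ⟨σ, h1, h2⟩ := h
  exact ⟨σ, h1.mono (by exact_mod_cast hST), fun e he => h2 e (hST he)⟩

theorem mem_vertices {A : Finset (Sym2 V)} {v : V} : v ∈ vertices A ↔ ∃ e ∈ A, v ∈ e := by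
  simp [vertices]

theorem toFinset_subset_vertices {A : Finset (Sym2 V)} {e : Sym2 V} (he : e ∈ A) :
    e.toFinset ⊆ vertices A := by
  intro v hv
  exact mem_vertices.2 ⟨e, he, by simpa using hv⟩

theorem card_toFinset_le (e : Sym2 V) : #e.toFinset ≤ 2 := by
  rw [Sym2.card_toFinset]; split_ifs <;> simp

theorem excess_nonneg (A : Finset (Sym2 V)) (f : Sym2 V → ℝ) (v : V) : 0 ≤ excess A f v :=
  le_max_left _ _

theorem load_add (A : Finset (Sym2 V)) (f g : Sym2 V → ℝ) (v : V) :
    load A (f + g) v = load A f v + load A g v := by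
  simp [load, sum_add_distrib]

theorem load_smul (A : Finset (Sym2 V)) (t : ℝ) (f : Sym2 V → ℝ) (v : V) :
    load A (t • f) v = t * load A f v := by
  simp [load, mul_sum]

theorem load_single {A : Finset (Sym2 V)} {e : Sym2 V} (he : e ∈ A) (t : ℝ) (v : V) :
    load A (Pi.single e t) v = if v ∈ e then t else 0 := by
  simp only [load, sum_filter, Pi.single_apply]
  rw [sum_eq_single e]
  · simp
  · intro b _ hb; simp [hb]
  · intro h; exact absurd he h

theorem le_load {A : Finset (Sym2 V)} {f : Sym2 V → ℝ} (hf : ∀ e, 0 ≤ f e) {e : Sym2 V}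
    (he : e ∈ A) {v : V} (hv : v ∈ e) : f e ≤ load A f v :=
  single_le_sum (f := f) (fun x _ => hf x) (mem_filter.2 ⟨he, hv⟩)

theorem load_nonneg {A : Finset (Sym2 V)} {f : Sym2 V → ℝ} (hf : ∀ e, 0 ≤ f e) (v : V) :
    0 ≤ load A f v :=
  sum_nonneg fun x _ => hf x

theorem load_eq_zero {A : Finset (Sym2 V)} (f : Sym2 V → ℝ) {v : V} (hv : v ∉ vertices A) :
    load A f v = 0 := by
  refine sum_eq_zero fun e he => absurd (mem_vertices.2 ⟨e, ?_⟩) hv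
  simpa using he

theorem sum_mul_load (A : Finset (Sym2 V)) (f : Sym2 V → ℝ) (c : V → ℝ) :
    ∑ v ∈ vertices A, c v * load A f v = ∑ e ∈ A, f e * ∑ v ∈ e.toFinset, c v := by
  simp only [load, sum_filter, mul_sum]
  rw [sum_comm]
  refine sum_congr rfl fun e he => ?_
  rw [← sum_subset (toFinset_subset_vertices he)]
  · refine sum_congr rfl fun v hv => ?_
    rw [if_pos (by simpa using hv), mul_comm]
  · intro v _ hv
    rw [if_neg (by simpa using hv), mul_zero]

/-! ### Quadratic penalty and weak duality -/

theorem excess_sq_le (x y : ℝ) :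
    max 0 (x + y - 1) ^ 2 ≤ max 0 (x - 1) ^ 2 + (2 * max 0 (x - 1) * y + y ^ 2) := by
  have h : |max 0 (x + y - 1)| ≤ |max 0 (x - 1) + y| := by
    rw [abs_of_nonneg (le_max_left _ _)]
    refine max_le (abs_nonneg _) (le_trans ?_ (le_abs_self _))
    linarith [le_max_right 0 (x - 1)]
  nlinarith [sq_le_sq.2 h]

/-- Second-order lower bound from `excess_sq_le`: each of the at most two ends of `e` contributes at
most `K * t ^ 2` to the error, hence `2 * K * t ^ 2`. -/
theorem le_penalizedSize_add_single {K : ℝ} (hK : 0 ≤ K) {A : Finset (Sym2 V)}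
    (f : Sym2 V → ℝ) {e : Sym2 V} (he : e ∈ A) (t : ℝ) :
    penalizedSize K A f + t * (1 - price K A f e) - 2 * K * t ^ 2 ≤
      penalizedSize K A (f + Pi.single e t) := by
  have h1 : ∑ x ∈ A, (f + Pi.single e t : Sym2 V → ℝ) x = ∑ x ∈ A, f x + t := by
    simp [sum_add_distrib, he]
  have h2 : ∑ v ∈ vertices A, excess A (f + Pi.single e t) v ^ 2 ≤
      ∑ v ∈ vertices A, excess A f v ^ 2 + ∑ v ∈ e.toFinset, (2 * excess A f v * t + t ^ 2) := by
    have h : ∑ v ∈ e.toFinset, (2 * excess A f v * t + t ^ 2) =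
        ∑ v ∈ vertices A, if v ∈ e then 2 * excess A f v * t + t ^ 2 else 0 := by
      refine sum_subset_zero_on_sdiff (toFinset_subset_vertices he) (fun v hv => ?_) fun v hv => ?_
      · simp only [mem_sdiff, Sym2.mem_toFinset] at hv
        simp [hv.2]
      · rw [if_pos (by simpa using hv)]
    rw [h, ← sum_add_distrib]
    refine sum_le_sum fun v _ => ?_
    have := excess_sq_le (load A f v) (if v ∈ e then t else 0)
    rw [excess, load_add, load_single he, excess]
    split_ifs at this ⊢ <;> simpa using this
  have h3 : (#e.toFinset : ℝ) ≤ 2 := by exact_mod_cast card_toFinset_le e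
  have h4 : K * ∑ v ∈ e.toFinset, (2 * excess A f v * t + t ^ 2) =
      t * price K A f e + K * (#e.toFinset * t ^ 2) := by
    rw [sum_add_distrib, price, sum_const, nsmul_eq_mul, mul_add, mul_sum, mul_sum]
    congr 1
    exact sum_congr rfl fun v _ => by ring
  have h5 := mul_le_mul_of_nonneg_left h2 hK
  have h6 := mul_le_mul_of_nonneg_left (mul_le_mul_of_nonneg_right h3 (sq_nonneg t)) hK
  rw [mul_add] at h5
  unfold penalizedSize
  rw [h1]
  linarith

/-- Weak duality between fractional matchings and fractional vertex covers. -/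
theorem fractionalMatchingNumber_le {A D : Finset (Sym2 V)} (hD : D ⊆ A) {w : V → ℝ}
    (hw : ∀ v, 0 ≤ w v) (hc : ∀ e ∈ D, 1 ≤ ∑ v ∈ e.toFinset, w v) :
    fractionalMatchingNumber D ≤ ∑ v ∈ vertices A, w v := by
  refine csSup_le (fractionalSizes_nonempty D) ?_
  rintro s ⟨f, ⟨h0, h1⟩, rfl⟩
  calc fractionalSize D f ≤ ∑ e ∈ D, f e * ∑ v ∈ e.toFinset, w v :=
        sum_le_sum fun e he => le_mul_of_one_le_right (h0 e he) (hc e he)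
    _ = ∑ v ∈ vertices D, w v * load D f v := (sum_mul_load D f w).symm
    _ ≤ ∑ v ∈ vertices D, w v :=
        sum_le_sum fun v _ => mul_le_of_le_one_right (hw v) (h1 v)
    _ ≤ ∑ v ∈ vertices A, w v :=
        sum_le_sum_of_subset_of_nonneg (biUnion_subset_biUnion_of_subset_left _ hD)
          fun v _ _ => hw v

/-! ### Compactness and supports -/

theorem isCompact_rainbowWeights (E : ι → Finset (Sym2 V)) (A : Finset (Sym2 V)) :
    IsCompact (rainbowWeights E A) := by
  have h : rainbowWeights E A = ⋃ S ∈ A.powerset.filter (IsRainbow E),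
      Set.pi Set.univ fun e => Set.Icc (0 : ℝ) (if e ∈ S then 2 else 0) := by
    ext f
    simp only [rainbowWeights, Set.mem_ofPred_eq, Set.mem_iUnion, mem_filter, mem_powerset,
      Set.mem_pi, Set.mem_univ, true_imp_iff, Set.mem_Icc, exists_prop]
    constructor
    · rintro ⟨h, S, hS, hR, h0⟩
      refine ⟨S, ⟨hS, hR⟩, fun e => ⟨(h e).1, ?_⟩⟩
      split_ifs with he
      · exact (h e).2
      · exact (h0 e he).le
    · rintro ⟨S, ⟨hS, hR⟩, h⟩
      refine ⟨fun e => ⟨(h e).1, (h e).2.trans (by split_ifs <;> norm_num)⟩, S, hS, hR, ?_⟩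
      intro e he
      have := h e
      rw [if_neg he] at this
      exact le_antisymm this.2 this.1
  rw [h]
  exact Finset.isCompact_biUnion _ fun S _ => isCompact_univ_pi fun e => isCompact_Icc

theorem zero_mem_rainbowWeights [Nonempty ι] (E : ι → Finset (Sym2 V)) (A : Finset (Sym2 V)) :
    (0 : Sym2 V → ℝ) ∈ rainbowWeights E A :=
  ⟨fun e => by simp, ∅, by simp, ⟨fun _ => Classical.arbitrary ι, by simp, by simp⟩, by simp⟩

theorem isRainbow_supp {E : ι → Finset (Sym2 V)} {A : Finset (Sym2 V)} {f : Sym2 V → ℝ}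
    (hf : f ∈ rainbowWeights E A) : IsRainbow E (supp A f) := by
  obtain ⟨_, S, _, hR, h0⟩ := hf
  refine hR.mono fun e he => ?_
  by_contra h
  exact (mem_filter.1 he).2 (h0 e h)

theorem eq_zero_of_notMem_supp {E : ι → Finset (Sym2 V)} {A : Finset (Sym2 V)} {f : Sym2 V → ℝ}
    (hf : f ∈ rainbowWeights E A) {e : Sym2 V} (he : e ∉ supp A f) : f e = 0 := by
  obtain ⟨_, S, hS, _, h0⟩ := hf
  by_contra h
  have heS : e ∈ S := by by_contra h'; exact h (h0 e h')
  exact he (mem_filter.2 ⟨hS heS, h⟩)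

theorem continuous_load (A : Finset (Sym2 V)) (v : V) : Continuous fun f => load A f v := by
  unfold load; fun_prop

theorem continuous_penalizedSize (K : ℝ) (A : Finset (Sym2 V)) :
    Continuous (penalizedSize K A) := by
  have := continuous_load A
  unfold penalizedSize excess
  fun_prop

/-! ### Moving along a kernel direction -/

/-- Increasing `t` from `0`, finitely many affine functions that are positive at `0`, not all
nondecreasing, stay nonnegative until one of them vanishes. -/
theorem exists_first_zero {κ : Type*} (J : Finset κ) (p q : κ → ℝ) (hp : ∀ j ∈ J, 0 < p j)
    (hq : ∃ j ∈ J, q j < 0) :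
    ∃ t : ℝ, 0 < t ∧ (∀ j ∈ J, 0 ≤ p j + t * q j) ∧ ∃ j ∈ J, p j + t * q j = 0 := by
  obtain ⟨j₀, hj₀, hq₀⟩ := hq
  obtain ⟨j, hj, hmin⟩ := exists_min_image (J.filter fun j => q j < 0) (fun j => p j / -q j)
    ⟨j₀, mem_filter.2 ⟨hj₀, hq₀⟩⟩
  rw [mem_filter] at hj
  have hpj := hp j hj.1
  have hqj : 0 < -q j := by linarith [hj.2]
  have ht : 0 < p j / -q j := div_pos hpj hqj
  refine ⟨p j / -q j, ht, fun i hi => ?_, j, hj.1, ?_⟩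
  · rcases lt_or_ge (q i) 0 with h | h
    · have h1 := hmin i (mem_filter.2 ⟨hi, h⟩)
      have h2 : p j / -q j * -q i ≤ p i := (le_div_iff₀ (by linarith)).1 h1
      linarith
    · have := hp i hi
      positivity
  · have : q j ≠ 0 := hj.2.ne
    field_simp
    ring

/-- The incidence matrix from `T` to `W` has more columns than rows, so it has a nonzero kernel
vector; its sign can be chosen to make the sum nonnegative. -/
theorem exists_load_eq_zero {A T : Finset (Sym2 V)} (hT : T ⊆ A) {W : Finset V} (h : #W < #T) :
    ∃ a : Sym2 V → ℝ, (∀ e ∉ T, a e = 0) ∧ (∃ e ∈ T, a e ≠ 0) ∧ (∀ v ∈ W, load A a v = 0) ∧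
      0 ≤ ∑ e ∈ A, a e := by
  let M : Matrix W T ℝ := Matrix.of fun v e => if (v : V) ∈ (e : Sym2 V) then 1 else 0
  obtain ⟨b, hb, hb0⟩ : ∃ b ∈ LinearMap.ker M.mulVecLin, b ≠ 0 := by
    refine (Submodule.ne_bot_iff _).1 (LinearMap.ker_ne_bot_of_finrank_lt ?_)
    simpa using h
  let a : Sym2 V → ℝ := fun e => if he : e ∈ T then b ⟨e, he⟩ else 0
  have ha0 : ∀ e ∉ T, a e = 0 := fun e he => by simp [a, he]
  have ha1 : ∃ e ∈ T, a e ≠ 0 := by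
    obtain ⟨e, he⟩ := Function.ne_iff.1 hb0
    exact ⟨e, e.2, by simpa [a] using he⟩
  have ha2 : ∀ v ∈ W, load A a v = 0 := by
    intro v hv
    have h1 : (M.mulVec b) ⟨v, hv⟩ = 0 := congrFun (LinearMap.mem_ker.1 hb) ⟨v, hv⟩
    rw [load, sum_filter, ← sum_subset hT, ← sum_coe_sort T]
    · refine Eq.trans ?_ h1
      simp [Matrix.mulVec, dotProduct, M, a]
    · intro e _ he
      simp [ha0 e he]
  rcases le_total 0 (∑ e ∈ A, a e) with hs | hs
  · exact ⟨a, ha0, ha1, ha2, hs⟩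
  · refine ⟨(-1 : ℝ) • a, fun e he => by simp [ha0 e he], ?_, fun v hv => ?_, ?_⟩
    · obtain ⟨e, he, h⟩ := ha1
      exact ⟨e, he, by simpa using h⟩
    · rw [load_smul, ha2 v hv, mul_zero]
    · simpa using hs

/-- The number of inequalities `0 ≤ f e` and `load A f v ≤ 1` that are strict. -/
noncomputable def slackCount (A : Finset (Sym2 V)) (f : Sym2 V → ℝ) : ℕ :=
  #(supp A f) + #{v ∈ vertices A | load A f v < 1}

theorem excess_eq_zero {A : Finset (Sym2 V)} {f : Sym2 V → ℝ} {v : V} (h : load A f v ≤ 1) :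
    excess A f v = 0 :=
  max_eq_left (by linarith)

/-- Move along a direction that fixes all loads at least `1`, until a support edge reaches weight
`0` or a smaller load reaches `1`. The penalty is unchanged, the size does not drop, and one strict
inequality is lost. -/
theorem exists_slackCount_lt (K : ℝ) {E : ι → Finset (Sym2 V)} {A : Finset (Sym2 V)}
    {f : Sym2 V → ℝ} (hf : f ∈ rainbowWeights E A) (hload : ∀ v, load A f v ≤ 2)
    (hcard : #{v ∈ vertices A | 1 ≤ load A f v} < #(supp A f)) :
    ∃ g ∈ rainbowWeights E A, penalizedSize K A f ≤ penalizedSize K A g ∧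
      slackCount A g < slackCount A f := by
  have hTA : supp A f ⊆ A := filter_subset _ _
  obtain ⟨a, ha0, ⟨e₀, he₀, hae₀⟩, haW, hsum⟩ := exists_load_eq_zero hTA hcard
  have hpos : ∀ e ∈ supp A f, 0 < f e := fun e he =>
    lt_of_le_of_ne (hf.1 e).1 (mem_filter.1 he).2.symm
  obtain ⟨t, ht, hnn, hzero⟩ := exists_first_zero
    ((supp A f).disjSum {v ∈ vertices A | load A f v < 1})
    (Sum.elim f fun v => 1 - load A f v) (Sum.elim a fun v => - load A a v)
    (by
      intro j hj
      rcases j with e | v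
      · exact hpos e (by simpa using hj)
      · have : v ∈ vertices A ∧ load A f v < 1 := by simpa using hj
        simpa using this.2)
    (by
      by_cases hneg : ∃ e ∈ supp A f, a e < 0
      · obtain ⟨e, he, h⟩ := hneg
        exact ⟨Sum.inl e, by simpa using he, by simpa using h⟩
      · push Not at hneg
        have hann : ∀ e, 0 ≤ a e := fun e => by
          by_cases he : e ∈ supp A f
          · exact hneg e he
          · exact (ha0 e he).ge
        have hv := Sym2.out_fst_mem e₀
        have h1 := le_load hann (hTA he₀) hv
        have h2 : 0 < a e₀ := lt_of_le_of_ne (hann e₀) hae₀.symm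
        have h3 : e₀.out.1 ∈ vertices A := mem_vertices.2 ⟨e₀, hTA he₀, hv⟩
        refine ⟨Sum.inr e₀.out.1, ?_, ?_⟩
        · simp only [inr_mem_disjSum, mem_filter]
          -- A nonnegative nonzero direction raises the load at an end of `e₀`; loads at least `1`
          -- are fixed, so this load is below `1` and its slack decreases.
          refine ⟨h3, lt_of_not_ge fun h => ?_⟩
          have := haW _ (mem_filter.2 ⟨h3, h⟩)
          linarith
        · simp only [Sum.elim_inr]
          linarith)
  have hloadg : ∀ v, load A (f + t • a) v = load A f v + t * load A a v := fun v => by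
    rw [load_add, load_smul]
  have hsupp : ∀ e ∉ supp A f, (f + t • a) e = 0 := fun e he => by
    simp [ha0 e he, eq_zero_of_notMem_supp hf he]
  have hg0 : ∀ e, 0 ≤ (f + t • a) e := fun e => by
    by_cases he : e ∈ supp A f
    · simpa using hnn (Sum.inl e) (by simpa using he)
    · exact (hsupp e he).ge
  have hlow : ∀ v ∈ vertices A, load A f v < 1 → load A (f + t • a) v ≤ 1 := fun v hv h => by
    have := hnn (Sum.inr v) (by simp [hv, h])
    simp only [Sum.elim_inr] at this
    rw [hloadg]
    linarith
  have hhigh : ∀ v ∈ vertices A, 1 ≤ load A f v → load A (f + t • a) v = load A f v :=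
    fun v hv h => by rw [hloadg, haW v (mem_filter.2 ⟨hv, h⟩), mul_zero, add_zero]
  have hle2 : ∀ v, load A (f + t • a) v ≤ 2 := fun v => by
    by_cases hv : v ∈ vertices A
    · rcases lt_or_ge (load A f v) 1 with h | h
      · exact (hlow v hv h).trans one_le_two
      · exact (hhigh v hv h).le.trans (hload v)
    · rw [load_eq_zero _ hv]; norm_num
  refine ⟨f + t • a, ⟨fun e => ⟨hg0 e, ?_⟩, supp A f, hTA, isRainbow_supp hf, hsupp⟩, ?_, ?_⟩
  · by_cases he : e ∈ supp A f
    · exact (le_load hg0 (hTA he) (Sym2.out_fst_mem e)).trans (hle2 _)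
    · rw [hsupp e he]; norm_num
  · have h1 : ∑ e ∈ A, (f + t • a) e = ∑ e ∈ A, f e + t * ∑ e ∈ A, a e := by
      simp [sum_add_distrib, mul_sum]
    have h2 : ∑ v ∈ vertices A, excess A (f + t • a) v ^ 2 =
        ∑ v ∈ vertices A, excess A f v ^ 2 := by
      refine sum_congr rfl fun v hv => ?_
      rcases lt_or_ge (load A f v) 1 with h | h
      · rw [excess_eq_zero (hlow v hv h), excess_eq_zero h.le]
      · rw [excess, hhigh v hv h, excess]
    rw [penalizedSize, penalizedSize, h1, h2]
    have := mul_nonneg ht.le hsum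
    linarith
  · have h1 : supp A (f + t • a) ⊆ supp A f := fun e he => by
      by_contra h
      exact (mem_filter.1 he).2 (hsupp e h)
    have h2 : ({v ∈ vertices A | load A (f + t • a) v < 1} : Finset V) ⊆
        {v ∈ vertices A | load A f v < 1} := fun v hv => by
      rw [mem_filter] at hv ⊢
      refine ⟨hv.1, lt_of_not_ge fun h => ?_⟩
      have := hhigh v hv.1 h
      linarith [hv.2]
    obtain ⟨j, hj, hj0⟩ := hzero
    rcases j with e | v
    · refine add_lt_add_of_lt_of_le (card_lt_card ⟨h1, fun h => ?_⟩) (card_le_card h2)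
      exact (mem_filter.1 (h (by simpa using hj))).2 (by simpa using hj0)
    · refine add_lt_add_of_le_of_lt (card_le_card h1) (card_lt_card ⟨h2, fun h => ?_⟩)
      have := (mem_filter.1 (h (inr_mem_disjSum.1 hj))).2
      rw [hloadg] at this
      simp only [Sum.elim_inr] at hj0
      linarith

/-! ### Optimality conditions at a maximizer -/

theorem exists_penalizedSize_maximizer [Nonempty ι] (K : ℝ) (E : ι → Finset (Sym2 V))
    (A : Finset (Sym2 V)) :
    ∃ f ∈ rainbowWeights E A,
      (∀ g ∈ rainbowWeights E A, penalizedSize K A g ≤ penalizedSize K A f) ∧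
      ∀ g ∈ rainbowWeights E A, penalizedSize K A f ≤ penalizedSize K A g →
        slackCount A f ≤ slackCount A g := by
  obtain ⟨f₀, hf₀, hmax⟩ := (isCompact_rainbowWeights E A).exists_isMaxOn
    ⟨0, zero_mem_rainbowWeights E A⟩ (continuous_penalizedSize K A).continuousOn
  have hne : {f | f ∈ rainbowWeights E A ∧
      penalizedSize K A f₀ ≤ penalizedSize K A f}.Nonempty := ⟨f₀, hf₀, le_rfl⟩
  -- Minimal slack among maximizers plays the role of an extreme point; it exists because the count
  -- is a natural number.
  refine ⟨Function.argminOn (slackCount A) _ hne, ?_⟩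
  have hmem := Function.argminOn_mem (slackCount A) _ hne
  refine ⟨hmem.1, fun g hg => (hmax hg).trans hmem.2, fun g hg hle => ?_⟩
  have hg' : g ∈ {f | f ∈ rainbowWeights E A ∧ penalizedSize K A f₀ ≤ penalizedSize K A f} :=
    ⟨hg, hmem.2.trans hle⟩
  exact Function.argminOn_le (slackCount A) _ hg'

theorem price_le_one {K : ℝ} (hK : 0 < K) {E : ι → Finset (Sym2 V)} {A : Finset (Sym2 V)}
    {f : Sym2 V → ℝ} (hf : f ∈ rainbowWeights E A)
    (hmax : ∀ g ∈ rainbowWeights E A, penalizedSize K A g ≤ penalizedSize K A f)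
    {e : Sym2 V} (he : e ∈ supp A f) : price K A f e ≤ 1 := by
  have heA : e ∈ A := (mem_filter.1 he).1
  have hpos : 0 < f e := lt_of_le_of_ne (hf.1 e).1 (mem_filter.1 he).2.symm
  by_contra! h
  -- Lowering `f e` by `s` gains at least `s * (price - 1) - 2 * K * s ^ 2`, which is positive for
  -- `s < (price - 1) / (2 * K)`.
  obtain ⟨s, hs0, hs⟩ := exists_between
    (show 0 < min (f e) ((price K A f e - 1) / (2 * K)) from
      lt_min hpos (div_pos (by linarith) (by positivity)))
  have hs1 := hs.trans_le (min_le_left _ _)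
  have hs2 := (lt_div_iff₀ (by positivity)).1 (hs.trans_le (min_le_right _ _))
  have hg : f + Pi.single e (-s) ∈ rainbowWeights E A := by
    refine ⟨fun x => ?_, supp A f, filter_subset _ _, isRainbow_supp hf, fun x hx => ?_⟩
    · by_cases hx : x = e
      · subst hx
        have := (hf.1 x).2
        simp only [Pi.add_apply, Pi.single_eq_same]
        constructor <;> linarith
      · simpa [hx] using hf.1 x
    · have hx' : x ≠ e := fun h => hx (h ▸ he)
      simpa [hx'] using eq_zero_of_notMem_supp hf hx
  have h1 := hmax _ hg
  have h2 := le_penalizedSize_add_single hK.le f heA (-s)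
  nlinarith

theorem one_le_price {K : ℝ} (hK : 0 < K) {E : ι → Finset (Sym2 V)} {A : Finset (Sym2 V)}
    {f : Sym2 V → ℝ} (hf : f ∈ rainbowWeights E A)
    (hmax : ∀ g ∈ rainbowWeights E A, penalizedSize K A g ≤ penalizedSize K A f)
    {e : Sym2 V} (heA : e ∈ A) (hfe : f e < 2) (hR : IsRainbow E (insert e (supp A f))) :
    1 ≤ price K A f e := by
  by_contra! h
  obtain ⟨s, hs0, hs⟩ := exists_between
    (show 0 < min (2 - f e) ((1 - price K A f e) / (2 * K)) from
      lt_min (by linarith) (div_pos (by linarith) (by positivity)))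
  have hs1 := hs.trans_le (min_le_left _ _)
  have hs2 := (lt_div_iff₀ (by positivity)).1 (hs.trans_le (min_le_right _ _))
  have hg : f + Pi.single e s ∈ rainbowWeights E A := by
    refine ⟨fun x => ?_, insert e (supp A f), insert_subset heA (filter_subset _ _), hR,
      fun x hx => ?_⟩
    · by_cases hx : x = e
      · subst hx
        have := (hf.1 x).1
        simp only [Pi.add_apply, Pi.single_eq_same]
        constructor <;> linarith
      · simpa [hx] using hf.1 x
    · rw [mem_insert, not_or] at hx
      simpa [hx.1] using eq_zero_of_notMem_supp hf hx.2
  have h1 := hmax _ hg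
  have h2 := le_penalizedSize_add_single hK.le f heA s
  nlinarith

/-- An overloaded vertex lies on a support edge, whose price is at most `1` and includes `2 * K`
times the excess. -/
theorem load_le_of_maximizer {K : ℝ} (hK : 1 ≤ K) {E : ι → Finset (Sym2 V)}
    {A : Finset (Sym2 V)} {f : Sym2 V → ℝ} (hf : f ∈ rainbowWeights E A)
    (hmax : ∀ g ∈ rainbowWeights E A, penalizedSize K A g ≤ penalizedSize K A f) (v : V) :
    load A f v ≤ 1 + 1 / (2 * K) := by
  have hK0 : 0 < 1 / (2 * K) := by positivity
  by_contra! h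
  obtain ⟨e, he, hne⟩ : ∃ e ∈ A.filter (v ∈ ·), f e ≠ 0 := by
    refine exists_ne_zero_of_sum_ne_zero (f := f) (ne_of_gt ?_)
    change 0 < load A f v
    linarith
  rw [mem_filter] at he
  have h1 := price_le_one (by linarith) hf hmax (mem_filter.2 ⟨he.1, hne⟩)
  have h2 : 2 * K * excess A f v ≤ price K A f e :=
    single_le_sum (f := fun v => 2 * K * excess A f v)
      (fun u _ => mul_nonneg (by linarith) (excess_nonneg A f u)) (by simpa using he.2)
  have h3 : load A f v - 1 ≤ excess A f v := le_max_right _ _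
  have h4 : 2 * K * (1 / (2 * K)) = 1 := by field_simp
  nlinarith

theorem IsRainbow.insert_of_card_lt [Fintype ι] {E : ι → Finset (Sym2 V)} {S : Finset (Sym2 V)}
    (hS : IsRainbow E S) (hcard : #S < Fintype.card ι) :
    ∃ i, ∀ e ∈ E i, IsRainbow E (insert e S) := by
  obtain ⟨σ, hinj, hσ⟩ := hS
  obtain ⟨i, hi⟩ : ∃ i, i ∉ S.image σ := by
    by_contra! h
    have := card_le_card (fun i _ => h i : (univ : Finset ι) ⊆ S.image σ)
    rw [card_univ] at this
    exact absurd (this.trans card_image_le) (not_le.2 hcard)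
  refine ⟨i, fun e he => ?_⟩
  by_cases heS : e ∈ S
  · rw [insert_eq_of_mem heS]
    exact ⟨σ, hinj, hσ⟩
  have hne : ∀ x ∈ S, x ≠ e := fun x hx h => heS (h ▸ hx)
  refine ⟨Function.update σ e i, ?_, ?_⟩
  · rw [coe_insert, Set.injOn_insert (by simpa using heS)]
    constructor
    · intro x hx y hy hxy
      rw [Function.update_of_ne (hne x hx), Function.update_of_ne (hne y hy)] at hxy
      exact hinj hx hy hxy
    · rintro ⟨x, hx, hxi⟩
      rw [Function.update_self, Function.update_of_ne (hne x hx)] at hxi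
      exact hi (mem_image.2 ⟨x, hx, hxi⟩)
  · intro x hx
    rcases mem_insert.1 hx with rfl | hx
    · simpa using he
    · simpa [Function.update_of_ne (hne x hx)] using hσ x hx

/-! ### Size of the maximizer and removal of the overload -/

/-- With `2 * n` sets of fractional matching number at least `n`, there is a rainbow weight function
of size `n` that overloads each vertex by an arbitrarily small amount at most. -/
theorem exists_load_le [Fintype ι] [Nonempty ι] {E : ι → Finset (Sym2 V)} {A : Finset (Sym2 V)}
    (hA : ∀ i, E i ⊆ A) {n : ℝ} (hn : (Fintype.card ι : ℝ) = 2 * n)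
    (hE : ∀ i, n ≤ fractionalMatchingNumber (E i)) {K : ℝ} (hK : 1 ≤ K) :
    ∃ f ∈ rainbowWeights E A, (∀ v, load A f v ≤ 1 + 1 / (2 * K)) ∧ n ≤ ∑ e ∈ A, f e := by
  obtain ⟨f, hf, hmax, hmin⟩ := exists_penalizedSize_maximizer K E A
  have hload := load_le_of_maximizer hK hf hmax
  have hK0 : 0 < K := by linarith
  have hK2 : 1 / (2 * K) < 1 := by rw [div_lt_one (by positivity)]; linarith
  have hf0 : ∀ e, 0 ≤ f e := fun e => (hf.1 e).1
  refine ⟨f, hf, hload, ?_⟩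
  rcases lt_or_ge #(supp A f) (Fintype.card ι) with hlt | hge
  · obtain ⟨i, hi⟩ := (isRainbow_supp hf).insert_of_card_lt hlt
    have hw : ∀ v, 0 ≤ 2 * K * excess A f v := fun v =>
      mul_nonneg (by positivity) (excess_nonneg A f v)
    calc n ≤ fractionalMatchingNumber (E i) := hE i
      _ ≤ ∑ v ∈ vertices A, 2 * K * excess A f v := by
          refine fractionalMatchingNumber_le (hA i) hw fun e he => ?_
          -- The cap `2` on weights is never attained, as loads stay below `2`; raising `f e` is
          -- therefore allowed.
          refine one_le_price hK0 hf hmax (hA i he) ?_ (hi e he)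
          have := le_load hf0 (hA i he) (Sym2.out_fst_mem e)
          have := hload e.out.1
          linarith
      _ ≤ ∑ v ∈ vertices A, 2 * K * excess A f v * load A f v := by
          refine sum_le_sum fun v _ => ?_
          rcases le_total (load A f v) 1 with h | h
          · simp [excess_eq_zero h]
          · exact le_mul_of_one_le_right (hw v) h
      _ = ∑ e ∈ A, f e * price K A f e := sum_mul_load A f _
      _ ≤ ∑ e ∈ A, f e := by
          refine sum_le_sum fun e he => ?_
          by_cases h : f e = 0
          · simp [h]
          · exact mul_le_of_le_one_right (hf0 e)
              (price_le_one hK0 hf hmax (mem_filter.2 ⟨he, h⟩))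
  · have hcard : #(supp A f) ≤ #{v ∈ vertices A | 1 ≤ load A f v} := by
      by_contra! h
      obtain ⟨g, hg, h1, h2⟩ := exists_slackCount_lt K hf
        (fun v => by linarith [hload v]) h
      exact absurd (hmin g hg h1) (not_le.2 h2)
    have h1 : (Fintype.card ι : ℝ) ≤ #{v ∈ vertices A | 1 ≤ load A f v} := by
      exact_mod_cast hge.trans hcard
    have h2 : (#{v ∈ vertices A | 1 ≤ load A f v} : ℝ) ≤ ∑ v ∈ vertices A, 1 * load A f v := by
      rw [card_eq_sum_ones, Nat.cast_sum, sum_filter]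
      refine sum_le_sum fun v _ => ?_
      split_ifs with h
      · simpa using h
      · simpa using load_nonneg hf0 v
    have h3 : ∑ e ∈ A, f e * ∑ v ∈ e.toFinset, (1 : ℝ) ≤ ∑ e ∈ A, f e * 2 := by
      refine sum_le_sum fun e _ => mul_le_mul_of_nonneg_left ?_ (hf0 e)
      simpa using (by exact_mod_cast card_toFinset_le e : (#e.toFinset : ℝ) ≤ 2)
    rw [sum_mul_load] at h2
    rw [← sum_mul] at h3
    linarith

theorem smul_mem_rainbowWeights {E : ι → Finset (Sym2 V)} {A : Finset (Sym2 V)}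
    {f : Sym2 V → ℝ} (hf : f ∈ rainbowWeights E A) {c : ℝ} (hc0 : 0 ≤ c) (hc1 : c ≤ 1) :
    c • f ∈ rainbowWeights E A := by
  obtain ⟨h, S, hS, hR, h0⟩ := hf
  refine ⟨fun e => ⟨mul_nonneg hc0 (h e).1, ?_⟩, S, hS, hR, fun e he => by simp [h0 e he]⟩
  exact (mul_le_of_le_one_left (h e).1 hc1).trans (h e).2

theorem exists_load_le_one [Fintype ι] [Nonempty ι] {E : ι → Finset (Sym2 V)}
    {A : Finset (Sym2 V)} (hA : ∀ i, E i ⊆ A) {n : ℝ} (hn : (Fintype.card ι : ℝ) = 2 * n)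
    (hE : ∀ i, n ≤ fractionalMatchingNumber (E i)) :
    ∃ f ∈ rainbowWeights E A, (∀ v, load A f v ≤ 1) ∧ n ≤ ∑ e ∈ A, f e := by
  have hclosed : IsClosed {f : Sym2 V → ℝ | ∀ v, load A f v ≤ 1} := by
    rw [Set.ofPred_forall]
    exact isClosed_iInter fun v => isClosed_le (continuous_load A v) continuous_const
  obtain ⟨f, ⟨hf, hf1⟩, hmax⟩ := ((isCompact_rainbowWeights E A).inter_right hclosed).exists_isMaxOn
    ⟨0, zero_mem_rainbowWeights E A, fun v => by simp [load]⟩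
    (f := fun f => ∑ e ∈ A, f e) (by fun_prop)
  refine ⟨f, hf, hf1, ?_⟩
  set s := ∑ e ∈ A, f e with hs
  have hs0 : 0 ≤ s := sum_nonneg fun e _ => (hf.1 e).1
  by_contra! hlt
  have hd : 0 < n - s := by linarith
  -- This `K` equals `n / (n - s)`. Rescaling `g` to loads at most `1` and comparing with the
  -- maximum `s` gives `K * (n - s) ≤ s / 2`, that is `n ≤ s / 2`, against `s < n`.
  have hK : 1 ≤ 1 + s / (n - s) := le_add_of_nonneg_right (by positivity)
  obtain ⟨g, hg, hg1, hgn⟩ := exists_load_le hA hn hE hK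
  set K := 1 + s / (n - s) with hKdef
  have hKs : K * (n - s) = n := by rw [hKdef]; field_simp; ring
  have hK0 : 0 < K := by linarith
  have hc : 0 < 1 + 1 / (2 * K) := by positivity
  have hmem : (1 + 1 / (2 * K))⁻¹ • g ∈
      rainbowWeights E A ∩ {f : Sym2 V → ℝ | ∀ v, load A f v ≤ 1} := by
    refine ⟨smul_mem_rainbowWeights hg (by positivity) (inv_le_one_of_one_le₀ ?_), fun v => ?_⟩
    · exact le_add_of_nonneg_right (by positivity)
    · rw [load_smul, inv_mul_le_iff₀ hc, mul_one]
      exact hg1 v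
  have h1 : ∑ e ∈ A, ((1 + 1 / (2 * K))⁻¹ • g) e ≤ s := hmax hmem
  simp only [Pi.smul_apply, smul_eq_mul, ← mul_sum] at h1
  rw [inv_mul_le_iff₀ hc] at h1
  have h2 : K * n ≤ K * ((1 + 1 / (2 * K)) * s) :=
    mul_le_mul_of_nonneg_left (hgn.trans h1) hK0.le
  have h3 : K * ((1 + 1 / (2 * K)) * s) = K * s + s / 2 := by field_simp
  linarith

theorem hasRainbowFractionalMatching_of_mem {E : ι → Finset (Sym2 V)} {A : Finset (Sym2 V)}
    {f : Sym2 V → ℝ} (hf : f ∈ rainbowWeights E A) (h1 : ∀ v, load A f v ≤ 1) :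
    HasRainbowFractionalMatching E (∑ e ∈ A, f e) := by
  obtain ⟨h, S, hS, ⟨σ, hinj, hσ⟩, h0⟩ := hf
  refine ⟨S, fun e => σ e, f, fun x y hxy => Subtype.ext (hinj x.2 y.2 hxy), fun e => hσ e e.2,
    ⟨fun e _ => (h e).1, fun v => ?_⟩, sum_subset hS fun e _ he => h0 e he⟩
  exact (sum_le_sum_of_subset_of_nonneg (filter_subset_filter _ hS) fun e _ _ => (h e).1).trans
    (h1 v)

end FractionalMatching

open FractionalMatching in
theorem theorem3 {V : Type*} (G : SimpleGraph V) (n : ℝ) (hn : 0 < n)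
    (m : ℕ) (hm : (m : ℝ) = 2 * n)
    (E : Fin m → Finset (Sym2 V)) (hEG : ∀ i, (E i : Set (Sym2 V)) ⊆ G.edgeSet)
    (hE : ∀ i, n ≤ fractionalMatchingNumber (E i)) :
    HasRainbowFractionalMatching E n := by
  classical
  have hm0 : 0 < m := by
    have : (0 : ℝ) < m := by linarith
    exact_mod_cast this
  have : Nonempty (Fin m) := ⟨⟨0, hm0⟩⟩
  obtain ⟨f, hf, hf1, hfn⟩ := exists_load_le_one (E := E) (A := Finset.univ.biUnion E)
    (fun i => Finset.subset_biUnion_of_mem E (Finset.mem_univ i)) (by simpa using hm) hE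
  set s := ∑ e ∈ Finset.univ.biUnion E, f e with hs
  have hs0 : 0 < s := hn.trans_le hfn
  -- The matching found may be larger than `n`; scaling by `n / s` makes its size exactly `n`.
  have hc0 : 0 ≤ n / s := by positivity
  have hc1 : n / s ≤ 1 := (div_le_one hs0).2 hfn
  have key := hasRainbowFractionalMatching_of_mem (smul_mem_rainbowWeights hf hc0 hc1) fun v => by
    rw [load_smul]
    exact mul_le_one₀ hc1 (load_nonneg (fun e => (hf.1 e).1) v) (hf1 v)
  simp only [Pi.smul_apply, smul_eq_mul, ← Finset.mul_sum] at key
  rwa [← hs, div_mul_cancel₀ _ hs0.ne'] at key
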